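/- **Setting.** Let $n,d,m$ be natural numbers and consider a bar framework in $\mathbb{R}^d$ with $n$ vertices and $m$ edges $E_1,\dots,E_m$. A configuration is a vector $p=(p_1,\dots,p_n)\in\mathbb{R}^{nd}$ with $p_i\in\mathbb{R}^d$, and $p_{i,1},p_{i,2}$ denote the end points of $E_i$. Let $f_1(p)=|p_{1,1}-p_{1,2}|^2$ be the squared length of the free edge, let $f_i(p)=|p_{i,1}-p_{i,2}|^2-l_i^2$ for $i=2,\dots,m$, and let $g_1,\dots,g_{d(d+1)/2}:\mathbb{R}^{nd}\to\mathbb{R}$ be smooth functions (the pinning scheme). Write $c=(f_2,\dots,f_m,g_1,\dots,g_{d(d+1)/2})$ for the list of $m-1+\frac{d(d+1)}{2}$ constraints. For a configuration $p$ put $$N(p)=\operatorname{span}\{\nabla c_i(p)\},\qquad T(p)=N(p)^\perp,\qquad \mathcal{M}(p)=\{q\in\mathbb{R}^{nd} : |q_{i,1}-q_{i,2}|=|p_{i,1}-p_{i,2}|,\ i=1,\dots,m\},$$ and let $\mathcal{T}(p)=\{(Ap_i+b)_{i=1}^n : A\in\mathbb{R}^{d\times d}\text{ skew-symmetric},\ b\in\mathbb{R}^d\}$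 be the space of infinitesimal rigid body motions. A point $p^*$ is a *non-degenerate index-$k$ saddle point* of $f_1$ subject to $c=0$, where $0<k<nd-(m-1)-\frac{d(d+1)}{2}$, if $c(p^*)=0$ and there are multipliers $\eta_i$ with $\nabla f_1(p^*)=\sum_i\eta_i\nabla c_i(p^*)$ such that the projected Hessian $P_T\big(\nabla^2 f_1(p^*)-\sum_i\eta_i\nabla^2c_i(p^*)\big)P_T$, with $P_T$ the orthogonal projection onto $T(p^*)$, has $k$ negative and $nd-(m-1)-\frac{d(d+1)}{2}-k$ positive eigenvalues (counted with multiplicity), and its kernel is $N(p^*)$. **Theorem.** Suppose that * $p^*$ is a non-degenerate index-$k$ saddle point of $f_1$ subject to $c=0$, where $0<k<nd-(m-1)-\frac{d(d+1)}{2}$; * (LICQ) $\nabla f_2(p^*),\dots,\nabla f_m(p^*),\nabla g_1(p^*),\dots,\nabla g_{d(d+1)/2}(p^*)$ are linearly independent; * (rigid body motions are non-degenerate and are removed by the pinning) $\dim\mathcal{T}(p^*)=\frac{d(d+1)}{2}$, and no non-zero $v\in\mathcal{T}(p^*)$ satisfies $\nabla g_j(p^*)\cdot v=0$ for all $j$.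 Then the bar framework at $p^*$ is * *flexible*: there is a smooth curve $t\mapsto p(t)$, defined for $|t|<\delta$ for some $\delta>0$, with $p(0)=p^*$, $p(t)\in\mathcal{M}(p^*)$ for all $t$, and $p'(0)\notin\mathcal{T}(p^*)$; and * *singular*: in no neighbourhood of $p^*$ is $\mathcal{M}(p^*)$ a smooth embedded $(nd-m)$-dimensional submanifold of $\mathbb{R}^{nd}$. -/

import Mathlib

open scoped ContDiff

noncomputable section

namespace BarFramework

/-! ### Constrained saddle points in a Euclidean space -/

section Saddle

variable {E : Type*} [NormedAddCommGroup E] [InnerProductSpace ℝ E] [FiniteDimensional ℝ E]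
variable {ι : Type*} [Fintype ι]

/-- Linear independence constraint qualification (LICQ) at `x`. -/
def LICQ (c : ι → E → ℝ) (x : E) : Prop :=
  LinearIndependent ℝ (fun i => gradient (c i) x)

/-- The normal space `N(x) = span {∇c_i(x)}`. -/
def normalSpace (c : ι → E → ℝ) (x : E) : Submodule ℝ E :=
  Submodule.span ℝ (Set.range fun i => gradient (c i) x)

/-- The tangent space `T(x) = N(x)^⊥`. -/
def tangentSpace (c : ι → E → ℝ) (x : E) : Submodule ℝ E :=
  (normalSpace c x)ᗮ

/-- The Hessian of `F` at `x`, as a linear operator. -/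
def hessian (F : E → ℝ) (x : E) : E →L[ℝ] E :=
  fderiv ℝ (gradient F) x

/-- The projected Hessian `P_T (∇²F - ∑ η_i ∇²c_i) P_T` of the Lagrangian, where `P_T` is the
orthogonal projection onto the tangent space. -/
def projectedHessian (F : E → ℝ) (c : ι → E → ℝ) (η : ι → ℝ) (x : E) : E →ₗ[ℝ] E :=
  ((tangentSpace c x).starProjection ∘L
    (hessian F x - ∑ i, η i • hessian (c i) x) ∘L
      (tangentSpace c x).starProjection : E →L[ℝ] E)

/-- `x` is a non-degenerate index-`k` saddle point of `F` subject to `c = 0`.  Eigenvalues are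
counted with multiplicity, through the dimension of the sum of the eigenspaces. -/
structure IsNondegenerateSaddle (F : E → ℝ) (c : ι → E → ℝ) (k : ℕ) (x : E) : Prop where
  index_pos : 0 < k
  index_lt : k + Fintype.card ι < Module.finrank ℝ E
  feasible : ∀ i, c i x = 0
  exists_multiplier : ∃ η : ι → ℝ,
    gradient F x - ∑ i, η i • gradient (c i) x = 0 ∧
    Module.finrank ℝ
      ↥(⨆ μ ∈ Set.Iio (0 : ℝ), Module.End.eigenspace (projectedHessian F c η x) μ) = k ∧
    Module.finrank ℝ
      ↥(⨆ μ ∈ Set.Ioi (0 : ℝ), Module.End.eigenspace (projectedHessian F c η x) μ)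
        + k + Fintype.card ι = Module.finrank ℝ E ∧
    Module.End.eigenspace (projectedHessian F c η x) 0 = normalSpace c x

/-- `S` is a smooth embedded submanifold of `E` near `x`, of dimension `dim E - codim`: some smooth
chart of `E` around `x` carries `S` to a linear subspace of that dimension. -/
def IsSmoothSubmanifoldAt (codim : ℕ) (S : Set E) (x : E) : Prop :=
  ∃ Φ : OpenPartialHomeomorph E E, x ∈ Φ.source ∧
    ContDiffOn ℝ ∞ Φ Φ.source ∧ ContDiffOn ℝ ∞ Φ.symm Φ.target ∧
    ∃ L : Submodule ℝ E, Module.finrank ℝ L + codim = Module.finrank ℝ E ∧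
      ∀ y ∈ Φ.source, y ∈ S ↔ Φ y ∈ L

end Saddle

/-! ### Bar frameworks -/

/-- Configurations of `n` points in `ℝ^d`, that is `ℝ^{nd}` with its Euclidean structure. -/
abbrev Config (n d : ℕ) : Type :=
  PiLp 2 (fun _ : Fin n => EuclideanSpace ℝ (Fin d))

variable {n d m : ℕ}

/-- The squared length of the edge `a`. -/
def sqLength (a : Fin n × Fin n) (p : Config n d) : ℝ :=
  ‖p a.1 - p a.2‖ ^ 2

/-- The configuration space `M(p)`: all configurations whose edges have the same lengths as
those of `p`. -/
def configSpace (edge : Fin m → Fin n × Fin n) (p : Config n d) : Set (Config n d) :=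
  {q | ∀ i, sqLength (edge i) q = sqLength (edge i) p}

/-- The space of infinitesimal rigid body motions of `p`: the velocities `v_i = A p_i + b` with
`A` skew-symmetric. -/
def rigidMotions (p : Config n d) : Submodule ℝ (Config n d) where
  carrier := {v | ∃ (A : EuclideanSpace ℝ (Fin d) →ₗ[ℝ] EuclideanSpace ℝ (Fin d))
    (b : EuclideanSpace ℝ (Fin d)),
      (∀ x y, inner ℝ (A x) y = -inner ℝ x (A y)) ∧ ∀ i, v i = A (p i) + b}
  zero_mem' := ⟨0, 0, by simp, by simp⟩
  add_mem' := by
    rintro v w ⟨A, b, hA, hv⟩ ⟨B, c, hB, hw⟩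
    refine ⟨A + B, b + c, fun x y => ?_, fun i => ?_⟩
    · rw [LinearMap.add_apply, LinearMap.add_apply, inner_add_left, inner_add_right, hA, hB]
      ring
    · rw [PiLp.add_apply, hv, hw, LinearMap.add_apply]
      abel
  smul_mem' := by
    rintro r v ⟨A, b, hA, hv⟩
    refine ⟨r • A, r • b, fun x y => ?_, fun i => ?_⟩
    · rw [LinearMap.smul_apply, LinearMap.smul_apply, real_inner_smul_left,
        real_inner_smul_right, hA]
      ring
    · rw [PiLp.smul_apply, hv, LinearMap.smul_apply, smul_add]

/-- A nonlinear flex of the framework at `p`: a smooth curve in `M(p)`, defined near time `0`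
and starting at `p`. -/
def IsNonlinearFlex (edge : Fin m → Fin n × Fin n) (p : Config n d) (γ : ℝ → Config n d) : Prop :=
  ∃ δ > 0, ContDiffOn ℝ ∞ γ (Set.Ioo (-δ) δ) ∧ γ 0 = p ∧
    ∀ t ∈ Set.Ioo (-δ) δ, γ t ∈ configSpace edge p

/-- The framework is flexible: it has a non-trivial nonlinear flex, that is, one whose initial
velocity is not an infinitesimal rigid body motion. -/
def IsFlexible (edge : Fin m → Fin n × Fin n) (p : Config n d) : Prop :=
  ∃ γ : ℝ → Config n d, IsNonlinearFlex edge p γ ∧ deriv γ 0 ∉ rigidMotions p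

/-- The framework is singular: near `p`, the configuration space `M(p)` is not a smooth
`(nd - m)`-dimensional manifold. -/
def IsSingular (edge : Fin m → Fin n × Fin n) (p : Config n d) : Prop :=
  ¬ IsSmoothSubmanifoldAt m (configSpace edge p) p

/-- The constraint functions: `f_i = |p_{i,1} - p_{i,2}|² - l_i²` for the edges `i` other than
the free one, and the pinning functions `g_j`. -/
def constraint (edge : Fin m → Fin n × Fin n) (free : Fin m) (l : Fin m → ℝ)
    (g : Fin (d * (d + 1) / 2) → Config n d → ℝ) :
    {i : Fin m // i ≠ free} ⊕ Fin (d * (d + 1) / 2) → Config n d → ℝ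
  | Sum.inl i => fun p => sqLength (edge i) p - l i ^ 2
  | Sum.inr j => g j

end BarFramework

end

namespace BarFramework

open Filter Topology

/-! The Lagrangian `L = F - F x - ∑ η_i c_i` vanishes to second order at the saddle `x`, and equals
`F - F x` where `c = 0`. Let `B` be its Hessian, `T` the tangent space and `R` the rigid motions. On
`T` the form `B` is indefinite and non-degenerate.

Blow-up: Hadamard's lemma gives `c_i (x + t u) = t q_i (t, u)` and `L (x + t u) = t² r (t, u)` with
`q_i`, `r` smooth. If `v ∈ T` is non-zero and null for `B`, then `(q, r)` vanishes at `(0, v)` and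
its derivative in `u` is onto, so the implicit function theorem yields `u t` with `u 0 = v`. Hence
`v` is the velocity of the curve `x + t u t` in the configuration space (`exists_curve_of_null`).

Flexibility: `B` has a non-zero null vector in `T`, and pinning makes `T` and `R` disjoint.
Singularity: null vectors span `T` (`le_of_null_mem`), and rigid motions are velocities too. A
tangent space would contain `T ⊕ R`, of dimension `nd - m + 1`, one too many. -/

/-! ### Smooth parameter integrals and Hadamard's lemma -/

theorem hasFDerivAt_intervalIntegral_of_contDiff {H G : Type*} [NormedAddCommGroup H]
    [NormedSpace ℝ H] [NormedAddCommGroup G] [NormedSpace ℝ G]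
    {f : H → ℝ → G} (hf : ContDiff ℝ ∞ (Function.uncurry f)) (x : H) :
    HasFDerivAt (fun x => ∫ t in (0 : ℝ)..1, f x t)
      (∫ t in (0 : ℝ)..1, fderiv ℝ (Function.uncurry f) (x, t) ∘L .inl ℝ H ℝ) x := by
  have hf' : Continuous (fderiv ℝ (Function.uncurry f)) := hf.continuous_fderiv (by simp)
  have hF' : Continuous (fun z : H × ℝ => fderiv ℝ (Function.uncurry f) z ∘L .inl ℝ H ℝ) := by
    fun_prop
  have hcomp : IsCompact (({x} : Set H) ×ˢ Set.Icc (0 : ℝ) 1) :=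
    isCompact_singleton.prod isCompact_Icc
  obtain ⟨C, hC⟩ := hcomp.bddAbove_image hF'.norm.continuousOn
  -- `H` need not be locally compact, so the bound on the derivative, uniform over `[0, 1]`, comes
  -- from a tube around `{x} × [0, 1]`.
  obtain ⟨U, V, hU, -, hxU, hV, hUV⟩ := generalized_tube_lemma (s := ({x} : Set H))
    isCompact_singleton (t := Set.Icc (0 : ℝ) 1) isCompact_Icc
    (n := {z | ‖fderiv ℝ (Function.uncurry f) z ∘L .inl ℝ H ℝ‖ < C + 1})
    (isOpen_lt hF'.norm continuous_const) (fun z hz => by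
      have := hC ⟨z, hz, rfl⟩
      simp only [Set.mem_ofPred_eq]
      simp only at this
      linarith)
  have hc := hf.continuous
  refine intervalIntegral.hasFDerivAt_integral_of_dominated_of_fderiv_le (bound := fun _ => C + 1)
    (F' := fun x t => fderiv ℝ (Function.uncurry f) (x, t) ∘L .inl ℝ H ℝ)
    (hU.mem_nhds (hxU rfl)) ?_ ?_ ?_ ?_ ?_ ?_
  · exact .of_forall fun y => (hc.comp (Continuous.prodMk_right y)).aestronglyMeasurable
  · exact (hc.comp (Continuous.prodMk_right x)).intervalIntegrable _ _
  · exact (hF'.comp (Continuous.prodMk_right x)).aestronglyMeasurable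
  · refine .of_forall fun t ht y hy => ?_
    rw [Set.uIoc_of_le zero_le_one] at ht
    exact le_of_lt (hUV (Set.mk_mem_prod hy (hV ⟨ht.1.le, ht.2⟩)))
  · exact continuous_const.intervalIntegrable _ _
  · refine .of_forall fun t ht y hy => ?_
    exact HasFDerivAt.comp (g := Function.uncurry f) (f := fun e => (e, t)) y
      ((hf.differentiable (by simp)) (y, t)).hasFDerivAt (hasFDerivAt_prodMk_left y t)

universe u v

/-- The derivative is an integral of the same kind with values in `H →L[ℝ] G`. The induction
therefore varies `G`, in a universe that also holds this operator space. -/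
theorem contDiff_intervalIntegral_nat {H : Type u} [NormedAddCommGroup H] [NormedSpace ℝ H]
    (n : ℕ) : ∀ {G : Type (max u v)} [NormedAddCommGroup G] [NormedSpace ℝ G]
      {f : H → ℝ → G}, ContDiff ℝ ∞ (Function.uncurry f) →
      ContDiff ℝ n (fun x => ∫ t in (0 : ℝ)..1, f x t) := by
  induction n with
  | zero =>
    intro G _ _ f hf
    exact contDiff_zero.2 (continuous_iff_continuousAt.2 fun x =>
      (hasFDerivAt_intervalIntegral_of_contDiff hf x).continuousAt)
  | succ n ih =>
    intro G _ _ f hf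
    push_cast
    rw [contDiff_succ_iff_fderiv]
    refine ⟨fun x => (hasFDerivAt_intervalIntegral_of_contDiff hf x).differentiableAt, by simp, ?_⟩
    rw [funext fun x => (hasFDerivAt_intervalIntegral_of_contDiff hf x).fderiv]
    refine ih (f := fun x t => fderiv ℝ (Function.uncurry f) (x, t) ∘L .inl ℝ H ℝ) ?_
    have := hf.fderiv_right (m := ∞) (by simp)
    exact this.clm_comp contDiff_const

/-- Hadamard's lemma: a smooth function vanishing on `t = 0` is smoothly divisible by `t`. -/
theorem exists_contDiff_eq_mul {E : Type} [NormedAddCommGroup E] [NormedSpace ℝ E]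
    {f : ℝ × E → ℝ} (hf : ContDiff ℝ ∞ f) (h0 : ∀ u, f (0, u) = 0) :
    ∃ q : ℝ × E → ℝ, ContDiff ℝ ∞ q ∧ (∀ t u, f (t, u) = t * q (t, u)) ∧
      ∀ u, q (0, u) = fderiv ℝ f (0, u) (1, 0) := by
  have hf' : ContDiff ℝ ∞ (fderiv ℝ f) := hf.fderiv_right (m := ∞) (by simp)
  refine ⟨fun z => ∫ τ in (0 : ℝ)..1, fderiv ℝ f (τ * z.1, z.2) (1, 0), ?_, ?_, ?_⟩
  · refine contDiff_infty.2 fun n => contDiff_intervalIntegral_nat n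
      (f := fun (z : ℝ × E) τ => fderiv ℝ f (τ * z.1, z.2) (1, 0)) ?_
    exact (hf'.comp (by fun_prop : ContDiff ℝ ∞ fun y : (ℝ × E) × ℝ => (y.2 * y.1.1, y.1.2))).clm_apply
      contDiff_const
  · intro t u
    have h : ∀ τ ∈ Set.uIcc (0 : ℝ) 1, HasDerivAt (fun τ : ℝ => f (τ * t, u))
        (t * fderiv ℝ f (τ * t, u) (1, 0)) τ := by
      intro τ _
      have h1 : HasDerivAt (fun τ : ℝ => ((τ * t, u) : ℝ × E)) (t, 0) τ :=
        (by simpa using (hasDerivAt_id τ).mul_const t : HasDerivAt (fun τ : ℝ => τ * t) t τ).prodMk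
          (hasDerivAt_const τ u)
      have h2 := (hf.differentiable (by simp) (τ * t, u)).hasFDerivAt.comp_hasDerivAt τ h1
      convert! h2 using 1
      rw [show ((t, 0) : ℝ × E) = t • ((1, 0) : ℝ × E) by simp, map_smul, smul_eq_mul]
    have hc : Continuous fun τ : ℝ => fderiv ℝ f (τ * t, u) (1, 0) :=
      (hf'.continuous.comp (by fun_prop : Continuous fun τ : ℝ => (τ * t, u))).clm_apply
        continuous_const
    have := intervalIntegral.integral_eq_sub_of_hasDerivAt h
      ((continuous_const.mul hc).intervalIntegrable _ _)
    rw [intervalIntegral.integral_const_mul] at this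
    simpa [h0] using this.symm
  · intro u
    simp

/-! ### Implicit functions and solution curves -/

/-- A smooth implicit function, smooth on a whole neighbourhood. -/
theorem exists_smooth_implicitFunction {E₁ E₂ F : Type*}
    [NormedAddCommGroup E₁] [NormedSpace ℝ E₁] [CompleteSpace E₁]
    [NormedAddCommGroup E₂] [NormedSpace ℝ E₂] [CompleteSpace E₂]
    [NormedAddCommGroup F] [NormedSpace ℝ F] [CompleteSpace F]
    {f : E₁ × E₂ → F} (hf : ContDiff ℝ ∞ f) (x₀ : E₁) (y₀ : E₂)
    (hinv : (fderiv ℝ f (x₀, y₀) ∘L .inr ℝ E₁ E₂).IsInvertible) :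
    ∃ ψ : E₁ → E₂, ψ x₀ = y₀ ∧
      ∀ᶠ x in 𝓝 x₀, ContDiffAt ℝ ∞ ψ x ∧ f (x, ψ x) = f (x₀, y₀) := by
  have hcd : ∀ u, ContDiffAt ℝ ∞ f u := fun u => hf.contDiffAt
  have hn : (∞ : WithTop ℕ∞) ≠ 0 := by simp
  let ψ := (hcd (x₀, y₀)).implicitFunction hn hinv
  have hψ0 : ψ x₀ = y₀ := (hcd (x₀, y₀)).implicitFunction_apply_self hn hinv
  have heq : ∀ᶠ x in 𝓝 x₀, f (x, ψ x) = f (x₀, y₀) :=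
    (hcd (x₀, y₀)).eventually_apply_implicitFunction hn hinv
  have hψ : ContDiffAt ℝ 1 ψ x₀ :=
    ((hcd (x₀, y₀)).contDiffAt_implicitFunction hn hinv).of_le (by simp)
  have hψc : ∀ᶠ x in 𝓝 x₀, ContinuousAt ψ x :=
    (hψ.eventually (by simp)).mono fun x hx => hx.continuousAt
  have hinv' : ∀ᶠ x in 𝓝 x₀, (fderiv ℝ f (x, ψ x) ∘L .inr ℝ E₁ E₂).IsInvertible := by
    have hc : ContinuousAt (fun x => fderiv ℝ f (x, ψ x) ∘L .inr ℝ E₁ E₂) x₀ := by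
      have h1 : ContinuousAt (fun x => fderiv ℝ f (x, ψ x)) x₀ :=
        ((hf.continuous_fderiv (by simp)).continuousAt).comp
          (continuousAt_id.prodMk hψ.continuousAt)
      exact h1.clm_comp continuousAt_const
    obtain ⟨e, he⟩ := hinv
    refine hc.eventually ?_
    simp only [hψ0, ← he]
    exact ContinuousLinearEquiv.nhds e
  refine ⟨ψ, hψ0, ?_⟩
  -- `ContDiffAt ℝ ∞` at `x₀` alone gives neighbourhoods that depend on the finite order. The
  -- theorem is reapplied at each nearby `(x, ψ x)`; by uniqueness its solution agrees with `ψ` near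
  -- `x`.
  filter_upwards [heq, heq.eventually_nhds, hψc, hinv'] with x hx hxn hxc hxi
  refine ⟨?_, hx⟩
  refine ((hcd (x, ψ x)).contDiffAt_implicitFunction hn hxi).congr_of_eventuallyEq ?_
  have ht : Tendsto (fun y => (y, ψ y)) (𝓝 x) (𝓝 (x, ψ x)) := continuousAt_id.prodMk hxc
  filter_upwards [hxn, ht.eventually
    ((hcd (x, ψ x)).eventually_apply_eq_iff_implicitFunction hn hxi)] with y hy hy'
  exact (hy'.1 (hy.trans hx.symm)).symm

/-- On the slice `v + R z`, with `R` a right inverse of the partial derivative, that derivative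
becomes the identity, so the implicit function theorem applies. -/
theorem exists_smooth_solution_curve {E F : Type*}
    [NormedAddCommGroup E] [NormedSpace ℝ E]
    [NormedAddCommGroup F] [NormedSpace ℝ F] [FiniteDimensional ℝ F]
    {f : ℝ × E → F} (hf : ContDiff ℝ ∞ f) (v : E)
    (hsurj : Function.Surjective fun w : E => fderiv ℝ f (0, v) (0, w)) :
    ∃ u : ℝ → E, u 0 = v ∧
      ∀ᶠ t in 𝓝 0, ContDiffAt ℝ ∞ u t ∧ f (t, u t) = f (0, v) := by
  obtain ⟨R₀, hR₀⟩ := ((fderiv ℝ f (0, v)).toLinearMap ∘ₗ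
    LinearMap.inr ℝ ℝ E).exists_rightInverse_of_surjective
    (LinearMap.range_eq_top.2 hsurj)
  let R : F →L[ℝ] E := LinearMap.toContinuousLinearMap R₀
  have hR : ∀ y, fderiv ℝ f (0, v) (0, R y) = y := fun y => LinearMap.congr_fun hR₀ y
  have : CompleteSpace F := FiniteDimensional.complete ℝ F
  let h : ℝ × F → ℝ × E := fun z => (z.1, v + R z.2)
  have hh : ContDiff ℝ ∞ h := by fun_prop
  have hfd : fderiv ℝ (f ∘ h) (0, 0) ∘L .inr ℝ ℝ F = ContinuousLinearMap.id ℝ F := by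
    have h1 : HasFDerivAt h ((ContinuousLinearMap.fst ℝ ℝ F).prod
        (R ∘L ContinuousLinearMap.snd ℝ ℝ F)) (0, 0) :=
      hasFDerivAt_fst.prodMk ((R.hasFDerivAt.comp _ hasFDerivAt_snd).const_add v)
    have h2 : HasFDerivAt f (fderiv ℝ f (0, v)) (h (0, 0)) := by
      simpa [h] using (hf.differentiable (by simp) (0, v)).hasFDerivAt
    rw [(h2.comp _ h1).fderiv]
    ext y
    simpa using hR y
  obtain ⟨ψ, hψ0, hψ⟩ := exists_smooth_implicitFunction (hf.comp hh) 0 0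
    (by rw [hfd]; exact ⟨ContinuousLinearEquiv.refl ℝ F, rfl⟩)
  refine ⟨fun t => v + R (ψ t), by simp [hψ0], ?_⟩
  filter_upwards [hψ] with t ht
  refine ⟨contDiffAt_const.add (R.contDiff.contDiffAt.comp t ht.1), ?_⟩
  simpa [h] using ht.2

/-! ### Gradients, Hessians and LICQ -/

section Gradient

variable {E : Type*} [NormedAddCommGroup E] [InnerProductSpace ℝ E] [FiniteDimensional ℝ E]

theorem inner_gradient_eq_fderiv (f : E → ℝ) (x w : E) :
    inner ℝ (gradient f x) w = fderiv ℝ f x w := by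
  rw [gradient, InnerProductSpace.toDual_symm_apply]

theorem inner_hessian_eq_fderiv {f : E → ℝ} (hf : ContDiff ℝ ∞ f) (x u w : E) :
    inner ℝ (hessian f x u) w = fderiv ℝ (fderiv ℝ f) x u w := by
  let J : (E →L[ℝ] ℝ) →L[ℝ] E := LinearMap.toContinuousLinearMap
    { toFun := fun φ => (InnerProductSpace.toDual ℝ E).symm φ
      map_add' := by simp
      map_smul' := by simp }
  have hJ : ∀ φ w, inner ℝ (J φ) w = φ w := fun φ w =>
    InnerProductSpace.toDual_symm_apply
  have hd : DifferentiableAt ℝ (fderiv ℝ f) x :=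
    (hf.fderiv_right (m := ∞) (by simp)).differentiable (by simp) x
  have hg : gradient f = fun y => J (fderiv ℝ f y) := rfl
  have h := (J.hasFDerivAt.comp x hd.hasFDerivAt).fderiv
  rw [hessian, hg]
  change inner ℝ (fderiv ℝ (J ∘ fderiv ℝ f) x u) w = _
  rw [h, ← hJ]
  rfl

theorem mem_tangentSpace_iff {ι : Type*} {c : ι → E → ℝ} {x v : E} :
    v ∈ tangentSpace c x ↔ ∀ i, fderiv ℝ (c i) x v = 0 := by
  rw [tangentSpace, normalSpace, Submodule.mem_orthogonal]
  constructor
  · intro h i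
    rw [← inner_gradient_eq_fderiv]
    exact h _ (Submodule.subset_span ⟨i, rfl⟩)
  · intro h u hu
    induction hu using Submodule.span_induction with
    | mem _ h' => obtain ⟨i, rfl⟩ := h'; rw [inner_gradient_eq_fderiv, h i]
    | zero => simp
    | add _ _ _ _ h1 h2 => rw [inner_add_left, h1, h2, add_zero]
    | smul a _ _ h1 => rw [real_inner_smul_left, h1, mul_zero]

theorem LICQ.finrank_tangentSpace {ι : Type*} [Fintype ι] {c : ι → E → ℝ} {x : E}
    (h : LICQ c x) :
    Module.finrank ℝ (tangentSpace c x) + Fintype.card ι = Module.finrank ℝ E := by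
  rw [← Submodule.finrank_add_finrank_orthogonal (normalSpace c x), normalSpace,
    finrank_span_eq_card h, add_comm]
  rfl

theorem LICQ.surjective {ι : Type*} [Fintype ι] {c : ι → E → ℝ} {x : E}
    (h : LICQ c x) (y : ι → ℝ) : ∃ w, ∀ i, fderiv ℝ (c i) x w = y i := by
  let D : E →ₗ[ℝ] (ι → ℝ) := LinearMap.pi fun i => (fderiv ℝ (c i) x).toLinearMap
  have hker : LinearMap.ker D = tangentSpace c x := by
    ext v
    rw [mem_tangentSpace_iff, LinearMap.mem_ker, funext_iff]
    rfl
  have h1 := D.finrank_range_add_finrank_ker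
  rw [hker, ← h.finrank_tangentSpace] at h1
  have h2 : LinearMap.range D = ⊤ := Submodule.eq_top_of_finrank_eq (by
    rw [Module.finrank_fintype_fun_eq_card]; omega)
  obtain ⟨w, hw⟩ := LinearMap.range_eq_top.1 h2 y
  exact ⟨w, fun i => congrFun hw i⟩

end Gradient

/-! ### Blow-up at a critical point -/

section Curve

variable {E : Type} [NormedAddCommGroup E] [NormedSpace ℝ E]

theorem exists_first_order_quotient {f : E → ℝ} (hf : ContDiff ℝ ∞ f) {x : E} (h0 : f x = 0) :
    ∃ q : ℝ × E → ℝ, ContDiff ℝ ∞ q ∧ (∀ t u, f (x + t • u) = t * q (t, u)) ∧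
      ∀ u, q (0, u) = fderiv ℝ f x u := by
  obtain ⟨q, hq, h1, h2⟩ := exists_contDiff_eq_mul (f := fun z : ℝ × E => f (x + z.1 • z.2))
    (hf.comp (by fun_prop)) (by simp [h0])
  refine ⟨q, hq, h1, fun u => ?_⟩
  rw [h2]
  have hF : ContDiff ℝ ∞ fun z : ℝ × E => f (x + z.1 • z.2) := hf.comp (by fun_prop)
  have h3 : HasDerivAt (fun t : ℝ => f (x + t • u)) _ 0 :=
    HasFDerivAt.comp_hasDerivAt (f := fun t : ℝ => (t, u)) 0
      (hF.differentiable (by simp) (0, u)).hasFDerivAt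
      ((hasDerivAt_id (0 : ℝ)).prodMk (hasDerivAt_const 0 u))
  have h4 : HasDerivAt (fun t : ℝ => f (x + t • u)) (fderiv ℝ f x u) 0 := by
    have hl : HasDerivAt (fun t : ℝ => x + t • u) u 0 := by
      simpa using ((hasDerivAt_id (0 : ℝ)).smul_const u).const_add x
    refine HasFDerivAt.comp_hasDerivAt 0 ?_ hl
    simpa using (hf.differentiable (by simp) x).hasFDerivAt
  exact h3.unique h4

theorem exists_second_order_quotient {f : E → ℝ} (hf : ContDiff ℝ ∞ f) {x : E} (h0 : f x = 0)
    (h0' : fderiv ℝ f x = 0) :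
    ∃ r : ℝ × E → ℝ, ContDiff ℝ ∞ r ∧ (∀ t u, f (x + t • u) = t ^ 2 * r (t, u)) ∧
      ∀ u, r (0, u) = fderiv ℝ (fderiv ℝ f) x u u / 2 := by
  obtain ⟨q, hq, hq1, hq0⟩ := exists_first_order_quotient hf h0
  obtain ⟨r, hr, hr1, -⟩ := exists_contDiff_eq_mul hq (by simp [hq0, h0'])
  have hfr : ∀ t u, f (x + t • u) = t ^ 2 * r (t, u) := fun t u => by rw [hq1, hr1]; ring
  refine ⟨r, hr, hfr, fun u => ?_⟩
  have hline : ∀ t : ℝ, HasDerivAt (fun t : ℝ => x + t • u) u t := fun t => by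
    simpa using ((hasDerivAt_id t).smul_const u).const_add x
  have hD : ∀ t : ℝ, HasDerivAt (fun t : ℝ => f (x + t • u)) (fderiv ℝ f (x + t • u) u) t :=
    fun t => (hf.differentiable (by simp) _).hasFDerivAt.comp_hasDerivAt t (hline t)
  have hρ : ContDiff ℝ ∞ fun t : ℝ => r (t, u) := hr.comp (by fun_prop)
  have hρd : ∀ t, HasDerivAt (fun t : ℝ => r (t, u)) (deriv (fun t : ℝ => r (t, u)) t) t :=
    fun t => (hρ.differentiable (by simp) t).hasDerivAt
  -- Both sides are the derivative of `f (x + t • u) = t² r (t, u)`. Differentiating them once more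
  -- at `t = 0` yields `2 r (0, u)` on the right.
  have heq : (fun t : ℝ => fderiv ℝ f (x + t • u) u) =
      fun t => t * (2 * r (t, u) + t * deriv (fun t : ℝ => r (t, u)) t) := by
    funext t
    have h1 := ((hasDerivAt_id t).pow 2).mul (hρd t)
    have h2 := hD t
    rw [funext fun t => hfr t u] at h2
    rw [h2.unique h1]
    simp
    ring
  have hd2 : HasDerivAt (fun t : ℝ => fderiv ℝ f (x + t • u) u)
      (fderiv ℝ (fderiv ℝ f) x u u) 0 := by
    have h1 : HasFDerivAt (fderiv ℝ f) (fderiv ℝ (fderiv ℝ f) x) (x + (0 : ℝ) • u) := by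
      simpa using ((hf.fderiv_right (m := ∞) (by simp)).differentiable (by simp) x).hasFDerivAt
    have h2 : HasDerivAt (fun t : ℝ => fderiv ℝ f (x + t • u)) (fderiv ℝ (fderiv ℝ f) x u) 0 :=
      HasFDerivAt.comp_hasDerivAt (f := fun t : ℝ => x + t • u) 0 h1 (hline 0)
    simpa using h2.clm_apply (hasDerivAt_const (0 : ℝ) u)
  have hdd : Differentiable ℝ (deriv fun t : ℝ => r (t, u)) :=
    (contDiff_infty_iff_deriv.1 hρ).2.differentiable (by simp)
  generalize deriv (fun t : ℝ => r (t, u)) = ρ' at hdd heq hρd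
  have h3 : HasDerivAt (fun t : ℝ => t * (2 * r (t, u) + t * ρ' t)) _ 0 :=
    (hasDerivAt_id' (0 : ℝ)).mul (((hρd 0).const_mul 2).add
      ((hasDerivAt_id' (0 : ℝ)).mul (hdd 0).hasDerivAt))
  rw [heq] at hd2
  have h4 := hd2.unique h3
  simp only [zero_mul, one_mul, add_zero] at h4
  linarith

/-- A tangent vector that is null for the Hessian of a function critical at `x` is the velocity of
a smooth curve on which the function and the constraints are constant, provided it is not in the
kernel of the Hessian on the tangent space. -/
theorem exists_curve_of_null {ι : Type} [Fintype ι] {L : E → ℝ} {c : ι → E → ℝ} {x v w : E}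
    (hL : ContDiff ℝ ∞ L) (hc : ∀ i, ContDiff ℝ ∞ (c i)) (hL0 : L x = 0) (hc0 : ∀ i, c i x = 0)
    (hcrit : fderiv ℝ L x = 0) (hsurj : ∀ y : ι → ℝ, ∃ w, ∀ i, fderiv ℝ (c i) x w = y i)
    (hv : ∀ i, fderiv ℝ (c i) x v = 0) (hnull : fderiv ℝ (fderiv ℝ L) x v v = 0)
    (hw : ∀ i, fderiv ℝ (c i) x w = 0) (hvw : fderiv ℝ (fderiv ℝ L) x v w ≠ 0) :
    ∃ γ : ℝ → E, γ 0 = x ∧ HasDerivAt γ v 0 ∧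
      ∀ᶠ t in 𝓝 0, ContDiffAt ℝ ∞ γ t ∧ (∀ i, c i (γ t) = 0) ∧ L (γ t) = 0 := by
  choose q hq hq1 hq0 using fun i => exists_first_order_quotient (hc i) (hc0 i)
  obtain ⟨r, hr, hr1, hr0⟩ := exists_second_order_quotient hL hL0 hcrit
  set D2 := fderiv ℝ (fderiv ℝ L) x with hD2
  have hsymm : ∀ a b, D2 a b = D2 b a := fun a b =>
    (hL.contDiffAt (x := x)).isSymmSndFDerivAt
      (by rw [minSmoothness_of_isRCLikeNormedField]; exact WithTop.coe_le_coe.2 le_top) a b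
  let Φ : ℝ × E → (ι → ℝ) × ℝ := fun z => (fun i => q i z, r z)
  have hΦ : ContDiff ℝ ∞ Φ := (contDiff_pi.2 hq).prodMk hr
  have hΦ' : ∀ a, fderiv ℝ Φ (0, v) (0, a) = (fun i => fderiv ℝ (c i) x a, D2 v a) := by
    intro a
    have h1 : HasFDerivAt (fun u : E => Φ (0, u)) (fderiv ℝ Φ (0, v) ∘L .inr ℝ ℝ E) v :=
      HasFDerivAt.comp (f := fun u : E => ((0 : ℝ), u)) v
        (hΦ.differentiable (by simp) (0, v)).hasFDerivAt (hasFDerivAt_prodMk_right 0 v)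
    -- At `t = 0` the blown-up system is explicit: linear in the constraints, quadratic in the
    -- Lagrangian.
    have he : (fun u : E => Φ (0, u)) =
        fun u => (fun i => fderiv ℝ (c i) x u, (1 / 2 : ℝ) * D2 u u) := by
      funext u
      simp only [Φ, hq0, hr0]
      ring_nf
    have h2 := (hasFDerivAt_pi.2 fun i => (fderiv ℝ (c i) x).hasFDerivAt (x := v)).prodMk
      ((D2.hasFDerivAt.clm_apply (hasFDerivAt_id v)).const_mul (1 / 2))
    rw [he] at h1
    have h3 := congrArg (fun T : E →L[ℝ] (ι → ℝ) × ℝ => T a) (h1.unique h2)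
    simp only [ContinuousLinearMap.comp_apply, ContinuousLinearMap.inr_apply] at h3
    rw [h3]
    ext i
    · simp
    · simp [hsymm a v]
      ring
  obtain ⟨u, hu0, hu⟩ := exists_smooth_solution_curve hΦ v (by
    rintro ⟨y, z⟩
    obtain ⟨w₀, hw₀⟩ := hsurj y
    -- `w₀` meets the constraint components; the tangent vector `w` leaves them alone and corrects
    -- the last component.
    refine ⟨w₀ + ((z - D2 v w₀) / D2 v w) • w, ?_⟩
    simp only [hΦ']
    ext i
    · simp [hw₀, hw]
    · simp only [map_add, map_smul, smul_eq_mul]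
      field_simp
      ring)
  have hΦ0 : Φ (0, v) = 0 := by
    ext i
    · simp [Φ, hq0, hv]
    · simp [Φ, hr0, hnull]
  refine ⟨fun t => x + t • u t, by simp, ?_, ?_⟩
  · have hud := (hu.self_of_nhds.1.differentiableAt (by simp)).hasDerivAt
    simpa [hu0] using ((hasDerivAt_id (0 : ℝ)).smul hud).const_add x
  · filter_upwards [hu] with t ht
    have h1 := ht.2.trans hΦ0
    refine ⟨contDiffAt_const.add (contDiffAt_id.smul ht.1), fun i => ?_, ?_⟩
    · rw [hq1, show q i (t, u t) = 0 from congrFun (congrArg Prod.fst h1) i, mul_zero]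
    · rw [hr1, show r (t, u t) = 0 from congrArg Prod.snd h1, mul_zero]

end Curve

/-! ### Null vectors of indefinite forms -/

section NullCone

variable {E : Type*} [AddCommGroup E] [Module ℝ E]

theorem exists_roots_of_mul_neg {α β γ : ℝ} (h : α * γ < 0) :
    ∃ s₁ s₂ : ℝ, s₁ ≠ s₂ ∧ α + 2 * s₁ * β + s₁ ^ 2 * γ = 0 ∧
      α + 2 * s₂ * β + s₂ ^ 2 * γ = 0 := by
  have hγ : γ ≠ 0 := by rintro rfl; simp at h
  have hd : 0 < β ^ 2 - α * γ := by nlinarith [sq_nonneg β]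
  have hs := Real.sq_sqrt hd.le
  have hs0 := Real.sqrt_pos.2 hd
  set ρ := √(β ^ 2 - α * γ)
  refine ⟨(-β + ρ) / γ, (-β - ρ) / γ, fun he => ?_, ?_, ?_⟩
  · rw [div_left_inj' hγ] at he
    linarith
  · field_simp
    linarith
  · field_simp
    linarith

/-- The null vectors of an indefinite quadratic form on a subspace span that subspace. -/
theorem le_of_null_mem (B : E →ₗ[ℝ] E →ₗ[ℝ] ℝ) (hB : ∀ a b, B a b = B b a)
    {T W : Submodule ℝ E} {a b : E} (ha : a ∈ T) (hb : b ∈ T) (haa : B a a < 0) (hbb : 0 < B b b)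
    (hW : ∀ v ∈ T, B v v = 0 → v ∈ W) : T ≤ W := by
  -- When the form has opposite signs at `x` and `y`, the line `x + s • y` meets the null cone at
  -- two distinct points. Their difference is a non-zero multiple of `y`, so `y`, and then `x`, lies
  -- in `W`.
  have key : ∀ x ∈ T, ∀ y ∈ T, B x x * B y y < 0 → x ∈ W := by
    intro x hx y hy hxy
    obtain ⟨s₁, s₂, hne, h₁, h₂⟩ := exists_roots_of_mul_neg (β := B x y) hxy
    have hexp : ∀ s : ℝ, B x x + 2 * s * B x y + s ^ 2 * B y y = 0 → x + s • y ∈ W := by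
      intro s hs
      refine hW _ (T.add_mem hx (T.smul_mem s hy)) ?_
      simp only [map_add, map_smul, LinearMap.add_apply, LinearMap.smul_apply, smul_eq_mul,
        hB y x]
      linarith
    have hyW : y ∈ W := by
      have h := W.sub_mem (hexp s₁ h₁) (hexp s₂ h₂)
      rw [add_sub_add_left_eq_sub, ← sub_smul] at h
      exact (W.smul_mem_iff (sub_ne_zero.2 hne)).1 h
    simpa using W.sub_mem (hexp s₁ h₁) (W.smul_mem s₁ hyW)
  intro x hx
  rcases lt_trichotomy (B x x) 0 with h | h | h
  · exact key x hx b hb (mul_neg_of_neg_of_pos h hbb)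
  · exact hW x hx h
  · exact key x hx a ha (mul_neg_of_pos_of_neg h haa)

end NullCone

/-! ### Curves through a non-degenerate saddle -/

section Saddle

variable {E : Type} [NormedAddCommGroup E] [InnerProductSpace ℝ E]
variable {ι : Type} [Fintype ι]

theorem exists_eigenvector_of_finrank_pos (f : E →ₗ[ℝ] E) (s : Set ℝ)
    (h : 0 < Module.finrank ℝ ↥(⨆ μ ∈ s, Module.End.eigenspace f μ)) :
    ∃ μ ∈ s, ∃ v, v ≠ 0 ∧ f v = μ • v := by
  by_contra! hne
  have hbot : (⨆ μ ∈ s, Module.End.eigenspace f μ) = ⊥ := by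
    simp only [iSup_eq_bot]
    intro μ hμ
    refine (Submodule.eq_bot_iff _).2 fun v hv => ?_
    by_contra hv0
    exact hne μ hμ v hv0 (Module.End.mem_eigenspace_iff.1 hv)
  rw [hbot, finrank_bot] at h
  exact lt_irrefl 0 h

theorem fderiv_lagrangian {F : E → ℝ} {c : ι → E → ℝ} (η : ι → ℝ) (hF : ContDiff ℝ ∞ F)
    (hc : ∀ i, ContDiff ℝ ∞ (c i)) (a : ℝ) :
    fderiv ℝ (fun y => F y - a - ∑ i, η i * c i y) =
      fun y => fderiv ℝ F y - ∑ i, η i • fderiv ℝ (c i) y := by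
  funext y
  exact (((hF.differentiable (by simp) y).hasFDerivAt.sub_const a).sub
    (HasFDerivAt.fun_sum fun i _ =>
      ((hc i).differentiable (by simp) y).hasFDerivAt.const_mul (η i))).fderiv

variable [FiniteDimensional ℝ E]

theorem inner_projectedHessian_of_mem {F : E → ℝ} {c : ι → E → ℝ} {η : ι → ℝ} {x v w : E}
    (hv : v ∈ tangentSpace c x) (hw : w ∈ tangentSpace c x) :
    inner ℝ (projectedHessian F c η x v) w =
      inner ℝ ((hessian F x - ∑ i, η i • hessian (c i) x) v) w := by
  have hPv := Submodule.starProjection_eq_self_iff.2 hv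
  have hPw := Submodule.starProjection_eq_self_iff.2 hw
  simp only [projectedHessian, ContinuousLinearMap.coe_coe, ContinuousLinearMap.comp_apply]
  rw [Submodule.inner_starProjection_left_eq_right, hPv, hPw]

theorem projectedHessian_mem (F : E → ℝ) (c : ι → E → ℝ) (η : ι → ℝ) (x v : E) :
    projectedHessian F c η x v ∈ tangentSpace c x :=
  Submodule.starProjection_apply_mem _ _

theorem fderiv_fderiv_lagrangian {F : E → ℝ} {c : ι → E → ℝ} (η : ι → ℝ) (hF : ContDiff ℝ ∞ F)
    (hc : ∀ i, ContDiff ℝ ∞ (c i)) (a : ℝ) (x v w : E) :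
    fderiv ℝ (fderiv ℝ (fun y => F y - a - ∑ i, η i * c i y)) x v w =
      inner ℝ ((hessian F x - ∑ i, η i • hessian (c i) x) v) w := by
  have hd : ∀ {f : E → ℝ}, ContDiff ℝ ∞ f →
      HasFDerivAt (fderiv ℝ f) (fderiv ℝ (fderiv ℝ f) x) x := fun hf =>
    ((hf.fderiv_right (m := ∞) (by simp)).differentiable (by simp) x).hasFDerivAt
  have h2 : HasFDerivAt (fun y => fderiv ℝ F y - ∑ i, η i • fderiv ℝ (c i) y) _ x :=
    (hd hF).sub (HasFDerivAt.fun_sum fun i _ => (hd (hc i)).const_smul (η i))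
  rw [fderiv_lagrangian η hF hc, h2.fderiv]
  simp [inner_sub_left, sum_inner, inner_smul_left, inner_hessian_eq_fderiv hF,
    inner_hessian_eq_fderiv (hc _)]

/-- Near a non-degenerate saddle point, every null direction of the Hessian is the velocity of a
smooth curve in the critical level set; the Hessian is indefinite on the tangent space. -/
theorem IsNondegenerateSaddle.exists_curves {F : E → ℝ} {c : ι → E → ℝ} {k : ℕ} {x : E}
    (h : IsNondegenerateSaddle F c k x) (hF : ContDiff ℝ ∞ F) (hc : ∀ i, ContDiff ℝ ∞ (c i))
    (hli : LICQ c x) :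
    ∃ B : E →ₗ[ℝ] E →ₗ[ℝ] ℝ, (∀ a b, B a b = B b a) ∧
      (∃ a ∈ tangentSpace c x, B a a < 0) ∧ (∃ b ∈ tangentSpace c x, 0 < B b b) ∧
      ∀ v ∈ tangentSpace c x, v ≠ 0 → B v v = 0 →
        ∃ γ : ℝ → E, γ 0 = x ∧ HasDerivAt γ v 0 ∧
          ∀ᶠ t in 𝓝 0, ContDiffAt ℝ ∞ γ t ∧ (∀ i, c i (γ t) = 0) ∧ F (γ t) = F x := by
  obtain ⟨hk, hlt, hfeas, η, hgrad, hneg, hpos, hker⟩ := h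
  let L : E → ℝ := fun y => F y - F x - ∑ i, η i * c i y
  have hL : ContDiff ℝ ∞ L := by fun_prop
  have hB := fderiv_fderiv_lagrangian η hF hc (F x) x
  have hsymm : ∀ a b, fderiv ℝ (fderiv ℝ L) x a b = fderiv ℝ (fderiv ℝ L) x b a := fun a b =>
    (hL.contDiffAt (x := x)).isSymmSndFDerivAt
      (by rw [minSmoothness_of_isRCLikeNormedField]; exact WithTop.coe_le_coe.2 le_top) a b
  -- The projected Hessian has its image in the tangent space, so eigenvectors with non-zero
  -- eigenvalue are tangent, and the eigenvalue gives the sign of the form.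
  have heig : ∀ μ v, μ ≠ 0 → projectedHessian F c η x v = μ • v →
      v ∈ tangentSpace c x ∧ fderiv ℝ (fderiv ℝ L) x v v = μ * ‖v‖ ^ 2 := by
    intro μ v hμ hv
    have hvT : v ∈ tangentSpace c x :=
      ((tangentSpace c x).smul_mem_iff hμ).1 (hv ▸ projectedHessian_mem F c η x v)
    refine ⟨hvT, ?_⟩
    rw [hB, ← inner_projectedHessian_of_mem hvT hvT, hv, real_inner_smul_left,
      real_inner_self_eq_norm_sq]
  refine ⟨(ContinuousLinearMap.coeLM ℝ).comp (fderiv ℝ (fderiv ℝ L) x).toLinearMap, hsymm,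
    ?_, ?_, ?_⟩
  · obtain ⟨μ, hμ, v, hv0, hv⟩ := exists_eigenvector_of_finrank_pos
      (projectedHessian F c η x) (Set.Iio 0) (by omega)
    obtain ⟨hvT, hQ⟩ := heig μ v (ne_of_lt hμ) hv
    exact ⟨v, hvT, hQ.trans_lt (mul_neg_of_neg_of_pos hμ (by positivity))⟩
  · obtain ⟨μ, hμ, v, hv0, hv⟩ := exists_eigenvector_of_finrank_pos
      (projectedHessian F c η x) (Set.Ioi 0) (by omega)
    obtain ⟨hvT, hQ⟩ := heig μ v (ne_of_gt hμ) hv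
    exact ⟨v, hvT, (mul_pos hμ (by positivity)).trans_eq hQ.symm⟩
  · intro v hv hv0 hnull
    have hvw : ∃ w ∈ tangentSpace c x, fderiv ℝ (fderiv ℝ L) x v w ≠ 0 := by
      -- Pairing `v` with its image `w` gives `‖w‖²`. If this is zero, `v` lies in the kernel
      -- `N(x)`, hence in `N(x) ∩ N(x)ᗮ = 0`.
      refine ⟨projectedHessian F c η x v, projectedHessian_mem F c η x v, fun h0 => hv0 ?_⟩
      rw [hB, ← inner_projectedHessian_of_mem hv (projectedHessian_mem F c η x v),
        inner_self_eq_zero] at h0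
      have hvN : v ∈ normalSpace c x := by
        rw [← hker, Module.End.mem_eigenspace_iff, h0, zero_smul]
      exact inner_self_eq_zero.1 (Submodule.inner_right_of_mem_orthogonal hvN hv)
    obtain ⟨w, hw, hvw⟩ := hvw
    have hcrit : fderiv ℝ L x = 0 := by
      ext w
      have h1 := congrArg (fun g => inner ℝ g w) hgrad
      simp only [inner_sub_left, sum_inner, real_inner_smul_left, inner_gradient_eq_fderiv,
        inner_zero_left] at h1
      rw [congrFun (fderiv_lagrangian η hF hc (F x)) x]
      simpa using h1
    obtain ⟨γ, h0, hγ, hev⟩ := exists_curve_of_null hL hc (by simp [L, hfeas]) hfeas hcrit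
      hli.surjective (mem_tangentSpace_iff.1 hv) hnull (mem_tangentSpace_iff.1 hw) hvw
    refine ⟨γ, h0, hγ, hev.mono fun t ht => ⟨ht.1, ht.2.1, ?_⟩⟩
    have := ht.2.2
    simp only [L, ht.2.1, mul_zero, Finset.sum_const_zero] at this
    linarith

end Saddle

/-! ### Tangent vectors of a submanifold -/

section Submanifold

variable {E : Type*} [NormedAddCommGroup E] [InnerProductSpace ℝ E] [FiniteDimensional ℝ E]

/-- `v` is the velocity at `x` of a differentiable curve in `S`. -/
def IsCurveVelocity {E : Type*} [NormedAddCommGroup E] [NormedSpace ℝ E] (S : Set E) (x v : E) :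
    Prop :=
  ∃ γ : ℝ → E, γ 0 = x ∧ HasDerivAt γ v 0 ∧ ∀ᶠ t in 𝓝 0, γ t ∈ S

/-- The velocities at `x` of the curves in a submanifold lie in a subspace of its dimension. -/
theorem IsSmoothSubmanifoldAt.exists_tangent {r : ℕ} {S : Set E} {x : E}
    (h : IsSmoothSubmanifoldAt r S x) :
    ∃ W : Submodule ℝ E, Module.finrank ℝ W + r ≤ Module.finrank ℝ E ∧
      ∀ v, IsCurveVelocity S x v → v ∈ W := by
  obtain ⟨Φ, hx, hΦ, hΦs, L, hL, hS⟩ := h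
  have hd : HasFDerivAt Φ (fderiv ℝ Φ x) x :=
    ((hΦ.contDiffAt (Φ.open_source.mem_nhds hx)).differentiableAt (by simp)).hasFDerivAt
  have hds : HasFDerivAt Φ.symm (fderiv ℝ Φ.symm (Φ x)) (Φ x) :=
    ((hΦs.contDiffAt (Φ.open_target.mem_nhds (Φ.map_source hx))).differentiableAt
      (by simp)).hasFDerivAt
  have hinv : ∀ v, fderiv ℝ Φ.symm (Φ x) (fderiv ℝ Φ x v) = v := by
    intro v
    have h1 := (hds.comp x hd).congr_of_eventuallyEq (f₁ := id) (by
      filter_upwards [Φ.open_source.mem_nhds hx] with y hy using (Φ.left_inv hy).symm)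
    exact congrArg (fun T : E →L[ℝ] E => T v) (h1.unique (hasFDerivAt_id x))
  refine ⟨L.comap (fderiv ℝ Φ x).toLinearMap, ?_, ?_⟩
  · rw [← hL]
    refine Nat.add_le_add_right ?_ r
    refine LinearMap.finrank_le_finrank_of_injective
      (f := (fderiv ℝ Φ x).toLinearMap.restrict (p := L.comap (fderiv ℝ Φ x).toLinearMap)
        (q := L) fun v hv => hv) fun a b hab => Subtype.ext ?_
    have h1 : fderiv ℝ Φ x a = fderiv ℝ Φ x b := congrArg Subtype.val hab
    rw [← hinv a, h1, hinv]
  · rintro v ⟨γ, h0, hγ, hev⟩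
    have h1 : HasDerivAt (Φ ∘ γ) (fderiv ℝ Φ x v) 0 :=
      (h0.symm ▸ hd : HasFDerivAt Φ (fderiv ℝ Φ x) (γ 0)).comp_hasDerivAt 0 hγ
    have hsrc : ∀ᶠ t in 𝓝 (0 : ℝ), γ t ∈ Φ.source :=
      hγ.continuousAt.eventually_mem (h0.symm ▸ Φ.open_source.mem_nhds hx)
    -- Membership in `L` is vanishing of the projection to `Lᗮ`, which passes to the derivative
    -- along the curve.
    have h2 : HasDerivAt (fun t => Lᗮ.starProjection (Φ (γ t)))
        (Lᗮ.starProjection (fderiv ℝ Φ x v)) 0 :=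
      Lᗮ.starProjection.hasFDerivAt.comp_hasDerivAt 0 h1
    have h3 : HasDerivAt (fun t => Lᗮ.starProjection (Φ (γ t))) 0 0 := by
      refine (hasDerivAt_const (0 : ℝ) (0 : E)).congr_of_eventuallyEq ?_
      filter_upwards [hsrc, hev] with t ht ht'
      rw [Submodule.starProjection_apply_eq_zero_iff, Submodule.orthogonal_orthogonal]
      exact (hS _ ht).1 ht'
    have h4 := h2.unique h3
    rwa [Submodule.starProjection_apply_eq_zero_iff, Submodule.orthogonal_orthogonal] at h4

end Submanifold

/-! ### Transversal curves and the dimension count -/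

section LevelSet

variable {E : Type} [NormedAddCommGroup E] [InnerProductSpace ℝ E] [FiniteDimensional ℝ E]
variable {ι : Type} [Fintype ι] {F : E → ℝ} {c : ι → E → ℝ} {k : ℕ} {x : E} {S : Set E}

theorem IsNondegenerateSaddle.exists_transversal_curve
    (h : IsNondegenerateSaddle F c k x) (hF : ContDiff ℝ ∞ F) (hc : ∀ i, ContDiff ℝ ∞ (c i))
    (hli : LICQ c x) (hS : ∀ y, (∀ i, c i y = 0) → F y = F x → y ∈ S)
    {R : Submodule ℝ E} (hR : Disjoint (tangentSpace c x) R) :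
    ∃ γ : ℝ → E, (∃ δ > 0, ContDiffOn ℝ ∞ γ (Set.Ioo (-δ) δ) ∧ γ 0 = x ∧
      ∀ t ∈ Set.Ioo (-δ) δ, γ t ∈ S) ∧ deriv γ 0 ∉ R := by
  obtain ⟨B, hsymm, ⟨a, ha, haa⟩, ⟨b, hb, hbb⟩, hcurve⟩ := h.exists_curves hF hc hli
  have hv : ∃ v ∈ tangentSpace c x, v ≠ 0 ∧ B v v = 0 := by
    by_contra! hne
    have hle : tangentSpace c x ≤ ⊥ := le_of_null_mem B hsymm ha hb haa hbb fun v hv hv0 => by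
      by_contra hv'
      exact hne v hv hv' hv0
    have ha0 : a = 0 := (Submodule.mem_bot ℝ).1 (hle ha)
    simp [ha0] at haa
  obtain ⟨v, hvT, hv0, hvv⟩ := hv
  obtain ⟨γ, h0, hγ, hev⟩ := hcurve v hvT hv0 hvv
  obtain ⟨δ, hδ, hball⟩ := Metric.eventually_nhds_iff_ball.1 hev
  rw [Real.ball_zero_eq_Ioo] at hball
  refine ⟨γ, ⟨δ, hδ, fun t ht => (hball t ht).1.contDiffWithinAt, h0,
    fun t ht => hS _ (hball t ht).2.1 (hball t ht).2.2⟩, ?_⟩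
  rw [hγ.deriv]
  exact fun hvR => hv0 (Submodule.disjoint_def.1 hR v hvT hvR)

/-- The subspace of velocities from `exists_tangent` contains both the tangent space of the
constraints and `R`. They are disjoint, so their dimensions add up, and LICQ gives the first one. -/
theorem IsNondegenerateSaddle.finrank_add_finrank_le
    (h : IsNondegenerateSaddle F c k x) (hF : ContDiff ℝ ∞ F) (hc : ∀ i, ContDiff ℝ ∞ (c i))
    (hli : LICQ c x) (hS : ∀ y, (∀ i, c i y = 0) → F y = F x → y ∈ S)
    {R : Submodule ℝ E} (hR : Disjoint (tangentSpace c x) R)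
    (hRS : ∀ v ∈ R, IsCurveVelocity S x v) {r : ℕ} (hr : IsSmoothSubmanifoldAt r S x) :
    Module.finrank ℝ R + r ≤ Fintype.card ι := by
  obtain ⟨B, hsymm, ⟨a, ha, haa⟩, ⟨b, hb, hbb⟩, hcurve⟩ := h.exists_curves hF hc hli
  obtain ⟨W, hW, hmem⟩ := hr.exists_tangent
  have hTW : tangentSpace c x ≤ W := le_of_null_mem B hsymm ha hb haa hbb fun v hv hvv => by
    rcases eq_or_ne v 0 with rfl | hv0
    · exact W.zero_mem
    · obtain ⟨γ, h0, hγ, hev⟩ := hcurve v hv hv0 hvv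
      exact hmem v ⟨γ, h0, hγ, hev.mono fun t ht => hS _ ht.2.1 ht.2.2⟩
  have hRW : R ≤ W := fun v hv => hmem v (hRS v hv)
  have h1 := Submodule.finrank_mono (sup_le hTW hRW)
  have h2 := Submodule.finrank_sup_add_finrank_inf_eq (tangentSpace c x) R
  rw [hR.eq_bot, finrank_bot] at h2
  have h3 := hli.finrank_tangentSpace
  omega

end LevelSet

/-! ### Rigid motions of a framework -/

section Rigid

variable {n d m : ℕ}

/-- The curve is `exp (t A)`, unitary because `A` is skew-adjoint. -/
theorem exists_isometry_curve (A : EuclideanSpace ℝ (Fin d) →ₗ[ℝ] EuclideanSpace ℝ (Fin d))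
    (hA : ∀ x y, inner ℝ (A x) y = -inner ℝ x (A y)) :
    ∃ U : ℝ → EuclideanSpace ℝ (Fin d) →L[ℝ] EuclideanSpace ℝ (Fin d),
      U 0 = 1 ∧ HasDerivAt U (LinearMap.toContinuousLinearMap A) 0 ∧ ∀ t x, ‖U t x‖ = ‖x‖ := by
  let A' := LinearMap.toContinuousLinearMap A
  let _ : NormedAlgebra ℚ (EuclideanSpace ℝ (Fin d) →L[ℝ] EuclideanSpace ℝ (Fin d)) :=
    .restrictScalars ℚ ℝ _
  have hA' : A' ∈ skewAdjoint (EuclideanSpace ℝ (Fin d) →L[ℝ] EuclideanSpace ℝ (Fin d)) := by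
    rw [skewAdjoint.mem_iff]
    refine ContinuousLinearMap.ext fun x => ext_inner_right ℝ fun y => ?_
    rw [ContinuousLinearMap.star_eq_adjoint, ContinuousLinearMap.adjoint_inner_left,
      neg_apply, inner_neg_left]
    exact (neg_eq_iff_eq_neg.2 (hA x y)).symm
  have h0 : NormedSpace.exp ((0 : ℝ) • A') = 1 := by
    rw [zero_smul ℝ A', NormedSpace.exp_zero]
  refine ⟨fun t => NormedSpace.exp (t • A'), h0, ?_, fun t x => ?_⟩
  · simpa only [h0, one_mul] using hasDerivAt_exp_smul_const A' (0 : ℝ)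
  · have hu := NormedSpace.exp_mem_unitary_of_mem_skewAdjoint (skewAdjoint.smul_mem t hA')
    exact ContinuousLinearMap.norm_map_of_mem_unitary hu x

theorem isCurveVelocity_of_hasDerivAt {E E' : Type*} [NormedAddCommGroup E] [NormedSpace ℝ E]
    [NormedAddCommGroup E'] [NormedSpace ℝ E'] (e : E' →L[ℝ] E) {S : Set E} {φ : ℝ → E'} {v' : E'}
    {x v : E} (hφ : HasDerivAt φ v' 0) (hx : e (φ 0) = x) (hv : e v' = v)
    (hS : ∀ t, e (φ t) ∈ S) : IsCurveVelocity S x v :=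
  ⟨fun t => e (φ t), hx, hv ▸ e.hasFDerivAt.comp_hasDerivAt 0 hφ, .of_forall hS⟩

/-- Move each vertex to `exp (t A) p_i + t b`: translations cancel in edge vectors and the
exponential preserves their norms. -/
theorem isCurveVelocity_of_mem_rigidMotions (edge : Fin m → Fin n × Fin n) {p v : Config n d}
    (hv : v ∈ rigidMotions p) : IsCurveVelocity (configSpace edge p) p v := by
  obtain ⟨A, b, hA, hv⟩ := hv
  obtain ⟨U, hU0, hU, hUn⟩ := exists_isometry_curve A hA
  have hpi : HasDerivAt (fun (t : ℝ) i => U t (p i) + t • b) (fun i => A (p i) + b) 0 := by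
    refine hasDerivAt_pi.2 fun i => ?_
    have h1 : HasDerivAt (fun t => U t (p i)) (A (p i)) 0 := by
      simpa using hU.clm_apply (hasDerivAt_const (0 : ℝ) (p i))
    have h2 : HasDerivAt (fun t : ℝ => t • b) b 0 := by
      simpa using (hasDerivAt_id (0 : ℝ)).smul_const b
    exact h1.add h2
  refine isCurveVelocity_of_hasDerivAt ((PiLp.continuousLinearEquiv 2 ℝ
    (fun _ : Fin n => EuclideanSpace ℝ (Fin d))).symm : _ →L[ℝ] Config n d) hpi ?_ ?_ ?_
  · refine PiLp.ext fun i => ?_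
    change U 0 (p i) + (0 : ℝ) • b = p i
    rw [hU0, zero_smul, add_zero]
    rfl
  · exact PiLp.ext fun i => (hv i).symm
  · intro t i
    change ‖(U t (p (edge i).1) + t • b) - (U t (p (edge i).2) + t • b)‖ ^ 2 = _
    rw [add_sub_add_right_eq_sub, ← map_sub, hUn]
    rfl

theorem contDiff_sqLength (a : Fin n × Fin n) :
    ContDiff ℝ ∞ (sqLength a : Config n d → ℝ) := by
  have h : ∀ i, ContDiff ℝ ∞ fun p : Config n d => p i := fun i =>
    (PiLp.proj 2 (𝕜 := ℝ) (fun _ : Fin n => EuclideanSpace ℝ (Fin d)) i).contDiff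
  exact ((h a.1).sub (h a.2)).norm_sq ℝ

end Rigid

end BarFramework

theorem theorem1 (n d m k : ℕ) (edge : Fin m → Fin n × Fin n) (free : Fin m) (l : Fin m → ℝ)
    (g : Fin (d * (d + 1) / 2) → BarFramework.Config n d → ℝ)
    (hg : ∀ j, ContDiff ℝ ∞ (g j))
    (p : BarFramework.Config n d)
    -- the rigid body motions of the framework form a `d(d+1)/2`-dimensional manifold
    (hrigid : Module.finrank ℝ (BarFramework.rigidMotions p) = d * (d + 1) / 2)
    -- the pinning scheme removes the rigid body motions
    (hpin : ∀ v ∈ BarFramework.rigidMotions p, (∀ j, fderiv ℝ (g j) p v = 0) → v = 0)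
    (hlicq : BarFramework.LICQ (BarFramework.constraint edge free l g) p)
    (hsaddle : BarFramework.IsNondegenerateSaddle (BarFramework.sqLength (edge free))
      (BarFramework.constraint edge free l g) k p) :
    BarFramework.IsFlexible edge p ∧ BarFramework.IsSingular edge p := by
  have hF := BarFramework.contDiff_sqLength (n := n) (d := d) (edge free)
  have hc : ∀ i, ContDiff ℝ ∞ (BarFramework.constraint edge free l g i) := by
    rintro (i | j)
    · exact (BarFramework.contDiff_sqLength (edge i)).sub contDiff_const
    · exact hg j
  have hS : ∀ q, (∀ i, BarFramework.constraint edge free l g i q = 0) →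
      BarFramework.sqLength (edge free) q = BarFramework.sqLength (edge free) p →
      q ∈ BarFramework.configSpace edge p := by
    intro q hq hfree i
    by_cases hi : i = free
    · rw [hi, hfree]
    · exact (sub_eq_zero.1 (hq (Sum.inl ⟨i, hi⟩))).trans
        (sub_eq_zero.1 (hsaddle.feasible (Sum.inl ⟨i, hi⟩))).symm
  have hR : Disjoint (BarFramework.tangentSpace (BarFramework.constraint edge free l g) p)
      (BarFramework.rigidMotions p) :=
    Submodule.disjoint_def.2 fun v hvT hvR => hpin v hvR fun j =>
      BarFramework.mem_tangentSpace_iff.1 hvT (Sum.inr j)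
  refine ⟨hsaddle.exists_transversal_curve hF hc hlicq hS hR, fun hsub => ?_⟩
  have h1 := hsaddle.finrank_add_finrank_le hF hc hlicq hS hR
    (fun v hv => BarFramework.isCurveVelocity_of_mem_rigidMotions edge hv) hsub
  -- There are `m - 1` edge constraints in truncated subtraction. As `m > 0`, `h1` becomes the false
  -- inequality `d(d+1)/2 + m ≤ (m - 1) + d(d+1)/2`.
  have hm : 0 < m := free.pos
  rw [hrigid, Fintype.card_sum, Fintype.card_fin, Fintype.card_subtype_compl,
    Fintype.card_subtype_eq, Fintype.card_fin] at h1
  omega
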